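/- For positive integers $\alpha_1,\dots,\alpha_r$ with $\alpha_r\ge 2$, let $$\zeta^\star(\alpha_1,\dots,\alpha_r)=\sum_{1\le k_1\le k_2\le\cdots\le k_r}k_1^{-\alpha_1}k_2^{-\alpha_2}\cdots k_r^{-\alpha_r}$$ be the multiple zeta-star value, let $\{2\}^a$ denote $a$ repetitions of $2$, let $\delta_{0a}$ be $1$ if $a=0$ and $0$ otherwise, and let $\zeta$ be the Riemann zeta function. Then for every integer $n\ge 0$, with sums over pairs of nonnegative integers $(a,b)$ with $a+b=n$, all the series $\zeta^\star(\{2\}^a,3,\{2\}^b)$ converge and $$\sum_{a+b=n}(2+\delta_{0a})\,\zeta^\star(\{2\}^a,3,\{2\}^b)=2(2n+2)\left(1-\frac1{2^{2n+2}}\right)\zeta(2n+3).$$ Equivalently, $$\zeta^\star(3,\{2\}^n)=2(2n+2)\left(1-\frac1{2^{2n+2}}\right)\zeta(2n+3)-2\sum_{a+b=n}\zeta^\star(\{2\}^a,3,\{2\}^b).$$ -/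

import Mathlib

/-- The term `k₁^{-α₁} ⋯ k_r^{-α_r}` of a multiple zeta-star series, for an index
`1 ≤ k₁ ≤ ⋯ ≤ k_r`, that is, a monotone map from `Fin r` to the positive integers. -/
noncomputable def mzsvTerm (α : List ℕ) (k : Fin α.length →o ℕ+) : ℝ :=
  ∏ i : Fin α.length, (((k i : ℕ) : ℝ) ^ α.get i)⁻¹

/-- The multiple zeta-star value
`ζ⋆(α₁, …, α_r) = ∑_{1 ≤ k₁ ≤ ⋯ ≤ k_r} k₁^{-α₁} ⋯ k_r^{-α_r}`. -/
noncomputable def zetaStar (α : List ℕ) : ℝ :=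
  ∑' k : Fin α.length →o ℕ+, mzsvTerm α k

/-- The exponent sequence `({2}^a, 3, {2}^b)`. -/
def twosThreeTwos (a b : ℕ) : List ℕ :=
  List.replicate a 2 ++ 3 :: List.replicate b 2

open Filter Topology

/-! Truncate every series at N, and let w = `centralRatio N k`, h = `harmonicGap N k`. Both the
truncated ζ⋆({2}^n) and the weighted sum of the truncated ζ⋆({2}^a,3,{2}^b) are finite alternating
sums over k with weights w (`truncStar_replicate_two`, `weightedTruncSum_eq`). These follow by
induction on n and N: peeling off a largest index equal to N + 1 gives a recurrence, which the
summands satisfy term by term (`weighted_recurrence`). As N → ∞, w → 1 and h → 0, so dominated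
convergence leaves 4(n+1) Σ (-1)^(k-1)/k^(2n+3), a multiple of ζ(2n+3). -/

/-- The part of a multiple zeta-star series with all summation indices in `[m, N]`. -/
noncomputable def truncStar : List ℕ → ℕ → ℕ → ℝ
  | [], _, _ => 1
  | s :: l, m, N => ∑ k ∈ Finset.Icc m N, ((k : ℝ) ^ s)⁻¹ * truncStar l k N

theorem truncStar_append_singleton_of_lt (l : List ℕ) (s : ℕ) {m N : ℕ} (h : N < m) :
    truncStar (l ++ [s]) m N = 0 := by
  cases l <;> simp [truncStar, Finset.Icc_eq_empty_of_lt h]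

theorem truncStar_append_singleton_succ (l : List ℕ) (s : ℕ) {m N : ℕ} (h : m ≤ N + 1) :
    truncStar (l ++ [s]) m (N + 1) =
      truncStar (l ++ [s]) m N + (((N + 1 : ℕ) : ℝ) ^ s)⁻¹ * truncStar l m (N + 1) := by
  induction l generalizing m with
  | nil => simp [truncStar, Finset.sum_Icc_succ_top h]
  | cons t l ih =>
    have h1 : ∀ k ∈ Finset.Icc m (N + 1), ((k : ℝ) ^ t)⁻¹ * truncStar (l ++ [s]) k (N + 1) =
        ((k : ℝ) ^ t)⁻¹ * truncStar (l ++ [s]) k N +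
          (((N + 1 : ℕ) : ℝ) ^ s)⁻¹ * (((k : ℝ) ^ t)⁻¹ * truncStar l k (N + 1)) := by
      intro k hk
      rw [ih (Finset.mem_Icc.1 hk).2]
      ring
    simp only [List.cons_append, truncStar]
    rw [Finset.sum_congr rfl h1, Finset.sum_add_distrib, ← Finset.mul_sum,
      Finset.sum_Icc_succ_top h (fun k : ℕ => ((k : ℝ) ^ t)⁻¹ * truncStar (l ++ [s]) k N),
      truncStar_append_singleton_of_lt l s (Nat.lt_succ_self N), mul_zero, add_zero]

theorem truncStar_nonneg (l : List ℕ) (m N : ℕ) : 0 ≤ truncStar l m N := by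
  induction l generalizing m with
  | nil => simp [truncStar]
  | cons s l ih =>
    exact Finset.sum_nonneg fun k _ => mul_nonneg (by positivity) (ih k)

/-! ### Truncations as partial sums over chains -/

theorem finite_boundedChains (r m N : ℕ) :
    {k : Fin r →o ℕ+ | ∀ i, m ≤ (k i : ℕ) ∧ (k i : ℕ) ≤ N}.Finite := by
  have h : (Set.pi Set.univ fun _ : Fin r => {x : ℕ+ | (x : ℕ) ≤ N}).Finite := by
    refine Set.Finite.pi fun _ => ?_
    exact (Set.finite_Iic N).preimage PNat.coe_injective.injOn
  refine (h.preimage (f := fun k : Fin r →o ℕ+ => (k : Fin r → ℕ+))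
    DFunLike.coe_injective.injOn).subset ?_
  intro k hk i _
  exact (hk i).2

/-- The chains `k₁ ≤ ⋯ ≤ k_r` of positive integers in `[m, N]`. -/
noncomputable def boundedChains (r m N : ℕ) : Finset (Fin r →o ℕ+) :=
  (finite_boundedChains r m N).toFinset

theorem mem_boundedChains {r m N : ℕ} {k : Fin r →o ℕ+} :
    k ∈ boundedChains r m N ↔ ∀ i, m ≤ (k i : ℕ) ∧ (k i : ℕ) ≤ N := by
  simp [boundedChains]

theorem monotone_fin_cons {r : ℕ} {x : ℕ+} {f : Fin r →o ℕ+} (h : ∀ i, x ≤ f i) :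
    Monotone (Fin.cons x f : Fin (r + 1) → ℕ+) := by
  intro i j hij
  induction i using Fin.cases with
  | zero =>
    induction j using Fin.cases with
    | zero => simp
    | succ j => simpa using h j
  | succ i =>
    induction j using Fin.cases with
    | zero => simp at hij
    | succ j => simpa using f.monotone (Fin.succ_le_succ_iff.1 hij)

/-- Split off the smallest index `k 0`; the remaining ones form a chain in `[k 0, N]`. -/
theorem sum_boundedChains (l : List ℕ) {m : ℕ} (hm : 1 ≤ m) (N : ℕ) :
    ∑ k ∈ boundedChains l.length m N, mzsvTerm l k = truncStar l m N := by
  induction l generalizing m with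
  | nil =>
    have : boundedChains ([] : List ℕ).length m N = {⟨Fin.elim0, fun i => i.elim0⟩} := by
      ext k
      simp only [mem_boundedChains, Finset.mem_singleton]
      exact ⟨fun _ => by ext i; exact i.elim0, fun _ i => i.elim0⟩
    rw [this]
    simp [mzsvTerm, truncStar]
  | cons s l ih =>
    have h1 : truncStar (s :: l) m N = ∑ j ∈ Finset.Icc m N,
        ∑ k ∈ boundedChains l.length j N, ((j : ℝ) ^ s)⁻¹ * mzsvTerm l k := by
      rw [truncStar]
      refine Finset.sum_congr rfl fun j hj => ?_
      rw [← ih (hm.trans (Finset.mem_Icc.1 hj).1), Finset.mul_sum]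
    rw [h1, Finset.sum_sigma']
    refine Finset.sum_bij'
      (fun k _ => ⟨(k 0 : ℕ), ⟨fun i => k i.succ, fun _ _ h =>
        k.monotone (Fin.succ_le_succ_iff.2 h)⟩⟩)
      (fun p hp => ⟨Fin.cons ⟨p.1, hm.trans
          (Finset.mem_Icc.1 (Finset.mem_sigma.1 hp).1).1⟩ p.2, monotone_fin_cons fun i =>
          (mem_boundedChains.1 (Finset.mem_sigma.1 hp).2 i).1⟩)
      ?_ ?_ ?_ ?_ ?_
    · intro k hk
      rw [mem_boundedChains] at hk
      simp only [Finset.mem_sigma, Finset.mem_Icc, mem_boundedChains]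
      refine ⟨hk 0, fun i => ⟨?_, (hk i.succ).2⟩⟩
      exact PNat.coe_le_coe _ _ |>.2 (k.monotone (Fin.zero_le _))
    · intro p hp
      have hp' := Finset.mem_sigma.1 hp
      have h2 := Finset.mem_Icc.1 hp'.1
      have h3 := mem_boundedChains.1 hp'.2
      rw [mem_boundedChains]
      intro i
      refine Fin.cases ?_ (fun i => ?_) i
      · exact h2
      · exact ⟨h2.1.trans (h3 i).1, (h3 i).2⟩
    · intro k hk
      ext i
      refine Fin.cases ?_ (fun i => ?_) i <;> rfl
    · intro p hp
      rfl
    · intro k hk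
      simp only [mzsvTerm]
      exact Fin.prod_univ_succ (n := l.length) _

theorem tendsto_boundedChains (r : ℕ) : Tendsto (boundedChains r 1) atTop atTop := by
  refine tendsto_atTop_finset_of_monotone ?_ ?_
  · intro a b hab k hk
    rw [mem_boundedChains] at hk ⊢
    exact fun i => ⟨(hk i).1, (hk i).2.trans hab⟩
  · intro k
    refine ⟨∑ i, (k i : ℕ), mem_boundedChains.2 fun i => ⟨(k i).2, ?_⟩⟩
    exact Finset.single_le_sum (f := fun i => (k i : ℕ)) (fun _ _ => Nat.zero_le _)
      (Finset.mem_univ i)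

theorem mzsvTerm_nonneg (l : List ℕ) (k : Fin l.length →o ℕ+) : 0 ≤ mzsvTerm l k :=
  Finset.prod_nonneg fun _ _ => by positivity

theorem summable_mzsvTerm_of_truncStar_le {l : List ℕ} {C : ℝ}
    (h : ∀ N, truncStar l 1 N ≤ C) : Summable (mzsvTerm l) := by
  refine summable_of_sum_le (c := C) (mzsvTerm_nonneg l) fun u => ?_
  obtain ⟨N, hN⟩ := ((tendsto_boundedChains l.length).eventually_ge_atTop u).exists
  calc ∑ k ∈ u, mzsvTerm l k ≤ ∑ k ∈ boundedChains l.length 1 N, mzsvTerm l k :=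
        Finset.sum_le_sum_of_subset_of_nonneg hN fun k _ _ => mzsvTerm_nonneg l k
    _ ≤ C := by rw [sum_boundedChains l le_rfl]; exact h N

theorem tendsto_truncStar {l : List ℕ} (h : Summable (mzsvTerm l)) :
    Tendsto (truncStar l 1) atTop (𝓝 (zetaStar l)) := by
  refine (h.hasSum.comp (tendsto_boundedChains l.length)).congr fun N => ?_
  exact sum_boundedChains l le_rfl N

/-! ### Binomial weights and harmonic gaps -/

/-- The quotient of binomial coefficients `C(2N, N + k) / C(2N, N)`. -/
noncomputable def centralRatio (N k : ℕ) : ℝ :=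
  ∏ i ∈ Finset.range k, ((N : ℝ) - i) / (N + i + 1)

/-- The difference of harmonic numbers `H_{N+k} - H_N`. -/
noncomputable def harmonicGap (N k : ℕ) : ℝ :=
  ∑ i ∈ Finset.range k, 1 / ((N : ℝ) + i + 1)

theorem centralRatio_succ (N k : ℕ) :
    centralRatio N (k + 1) = centralRatio N k * (((N : ℝ) - k) / (N + k + 1)) :=
  Finset.prod_range_succ _ _

theorem harmonicGap_succ (N k : ℕ) :
    harmonicGap N (k + 1) = harmonicGap N k + 1 / ((N : ℝ) + k + 1) :=
  Finset.sum_range_succ _ _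

theorem centralRatio_succ_right (N k : ℕ) :
    centralRatio N (k + 1) * (N + k + 1) = centralRatio N k * (N - k) := by
  have : (N : ℝ) + k + 1 ≠ 0 := by positivity
  rw [centralRatio_succ]
  field_simp

/-- This makes w_{N+1}(k)/(N+1)² equal to (w_{N+1}(k) - w_N(k))/k² for k > 0, so summing over N
trades 1/N² for 1/k². -/
theorem centralRatio_succ_left (N k : ℕ) :
    centralRatio N k =
      centralRatio (N + 1) k * ((N + 1) ^ 2 - (k : ℝ) ^ 2) / ((N : ℝ) + 1) ^ 2 := by
  induction k with
  | zero => simp [centralRatio]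
            field_simp
  | succ k ih =>
    have h1 : (N : ℝ) + k + 1 ≠ 0 := by positivity
    have h2 : (N : ℝ) + 1 + k + 1 ≠ 0 := by positivity
    have h3 : (N : ℝ) + 1 ≠ 0 := by positivity
    rw [centralRatio_succ, ih, centralRatio_succ]
    push_cast
    field_simp
    ring

theorem centralRatio_eq_zero {N k : ℕ} (h : N < k) : centralRatio N k = 0 :=
  Finset.prod_eq_zero (Finset.mem_range.2 h) (by simp)

theorem centralRatio_nonneg (N k : ℕ) : 0 ≤ centralRatio N k := by
  rcases lt_or_ge N k with h | h
  · exact (centralRatio_eq_zero h).ge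
  · refine Finset.prod_nonneg fun i hi => div_nonneg ?_ (by positivity)
    have : (i : ℝ) ≤ N := by exact_mod_cast (Finset.mem_range.1 hi).le.trans h
    linarith

theorem centralRatio_le_one (N k : ℕ) : centralRatio N k ≤ 1 := by
  rcases lt_or_ge N k with h | h
  · rw [centralRatio_eq_zero h]; exact zero_le_one
  · refine Finset.prod_le_one (fun i hi => div_nonneg ?_ (by positivity)) fun i hi => ?_
    · have : (i : ℝ) ≤ N := by exact_mod_cast (Finset.mem_range.1 hi).le.trans h
      linarith
    · rw [div_le_one (by positivity)]
      have : (0 : ℝ) ≤ i := Nat.cast_nonneg i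
      linarith

theorem harmonicGap_succ_left (N k : ℕ) :
    harmonicGap N k = harmonicGap (N + 1) k + 1 / ((N : ℝ) + 1) - 1 / (N + 1 + k) := by
  induction k with
  | zero => simp [harmonicGap]
  | succ k ih =>
    rw [harmonicGap_succ, ih, harmonicGap_succ]
    push_cast
    ring

theorem harmonicGap_nonneg (N k : ℕ) : 0 ≤ harmonicGap N k :=
  Finset.sum_nonneg fun i _ => by positivity

theorem centralRatio_mul_harmonicGap_le_one (N k : ℕ) :
    centralRatio N k * harmonicGap N k ≤ 1 := by
  rcases lt_or_ge N k with h | h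
  · rw [centralRatio_eq_zero h, zero_mul]; exact zero_le_one
  · refine mul_le_one₀ (centralRatio_le_one N k) (harmonicGap_nonneg N k) ?_
    have h1 : ∀ i ∈ Finset.range k, 1 / ((N : ℝ) + i + 1) ≤ 1 / ((N : ℝ) + 1) := fun i _ => by
      apply one_div_le_one_div_of_le (by positivity)
      have : (0 : ℝ) ≤ i := Nat.cast_nonneg i
      linarith
    refine (Finset.sum_le_sum h1).trans ?_
    have : (k : ℝ) ≤ N := by exact_mod_cast h
    rw [Finset.sum_const, Finset.card_range, nsmul_eq_mul, mul_one_div,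
      div_le_one (by positivity)]
    linarith

theorem tendsto_centralRatio (k : ℕ) : Tendsto (fun N => centralRatio N k) atTop (𝓝 1) := by
  have h : ∀ i ∈ Finset.range k,
      Tendsto (fun N : ℕ => ((N : ℝ) - i) / (N + i + 1)) atTop (𝓝 1) := fun i _ => by
    have h1 : Tendsto (fun N : ℕ => (N : ℝ) + i + 1) atTop atTop :=
      tendsto_atTop_add_const_right _ _
        (tendsto_atTop_add_const_right _ _ tendsto_natCast_atTop_atTop)
    have h2 : Tendsto (fun N : ℕ => 1 - (2 * (i : ℝ) + 1) / (N + i + 1)) atTop (𝓝 (1 - 0)) :=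
      tendsto_const_nhds.sub (h1.const_div_atTop _)
    rw [sub_zero] at h2
    refine h2.congr fun N => ?_
    have : (N : ℝ) + i + 1 ≠ 0 := by positivity
    field_simp
    ring
  have := tendsto_finsetProd (Finset.range k) h
  rwa [Finset.prod_const_one] at this

theorem tendsto_harmonicGap (k : ℕ) : Tendsto (fun N => harmonicGap N k) atTop (𝓝 0) := by
  have h : ∀ i ∈ Finset.range k,
      Tendsto (fun N : ℕ => 1 / ((N : ℝ) + i + 1)) atTop (𝓝 0) := fun i _ =>
    (tendsto_atTop_add_const_right _ _
        (tendsto_atTop_add_const_right _ _ tendsto_natCast_atTop_atTop)).const_div_atTop _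
  have := tendsto_finsetSum (Finset.range k) h
  rwa [Finset.sum_const_zero] at this

/-! ### Alternating sums of the weights -/

/-- Telescoping: `centralRatio_succ_right` gives 2N w(K+1) = w(K)(N-K) + w(K+1)(N-K-1). The boundary
term vanishes at K = N. -/
theorem sum_alternating_centralRatio_partial {N : ℕ} (hN : 0 < N) (K : ℕ) :
    ∑ k ∈ Finset.range K, (-1) ^ k * centralRatio N (k + 1) =
      1 / 2 - (-1) ^ K * (centralRatio N K * (N - K)) / (2 * N) := by
  have h0 : (N : ℝ) ≠ 0 := by positivity
  induction K with
  | zero => simp [centralRatio]; field_simp; norm_num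
  | succ K ih =>
    rw [Finset.sum_range_succ, ih, ← centralRatio_succ_right]
    push_cast
    field_simp
    ring

theorem sum_alternating_centralRatio {N : ℕ} (hN : 0 < N) :
    ∑ k ∈ Finset.range N, (-1) ^ k * centralRatio N (k + 1) = 1 / 2 := by
  rw [sum_alternating_centralRatio_partial hN]
  simp

/-- Summation by parts in the same telescope: the increment 1/(N+K+1) of h cancels the factor in
w(K+1)(N+K+1), leaving the unweighted sum. -/
theorem sum_alternating_centralRatio_mul_harmonicGap_partial {N : ℕ} (hN : 0 < N) (K : ℕ) :
    ∑ k ∈ Finset.range K, (-1) ^ k * centralRatio N (k + 1) * harmonicGap N (k + 1) =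
      (∑ k ∈ Finset.range K, (-1) ^ k * centralRatio N (k + 1)) / (2 * N) -
        (-1) ^ K * (centralRatio N K * (N - K)) * harmonicGap N K / (2 * N) := by
  have h0 : (N : ℝ) ≠ 0 := by positivity
  induction K with
  | zero => simp [harmonicGap]
  | succ K ih =>
    have h1 : (N : ℝ) + K + 1 ≠ 0 := by positivity
    have h2 : harmonicGap N K = harmonicGap N (K + 1) - 1 / ((N : ℝ) + K + 1) := by
      rw [harmonicGap_succ]; ring
    rw [Finset.sum_range_succ, ih, ← centralRatio_succ_right, Finset.sum_range_succ, h2]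
    push_cast
    field_simp
    ring

theorem sum_alternating_centralRatio_mul_harmonicGap {N : ℕ} (hN : 0 < N) :
    ∑ k ∈ Finset.range N, (-1) ^ k * centralRatio N (k + 1) * harmonicGap N (k + 1) =
      1 / (4 * N) := by
  have h0 : (N : ℝ) ≠ 0 := by positivity
  rw [sum_alternating_centralRatio_mul_harmonicGap_partial hN, sum_alternating_centralRatio hN]
  simp
  field_simp
  norm_num

theorem sum_range_centralRatio_mul (N : ℕ) (f : ℕ → ℝ) :
    ∑ k ∈ Finset.range N, centralRatio N (k + 1) * f k =
      ∑ k ∈ Finset.range (N + 1), centralRatio N (k + 1) * f k := by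
  rw [Finset.sum_range_succ, centralRatio_eq_zero (Nat.lt_succ_self N)]
  simp

/-! ### Closed forms for the truncations -/

theorem truncStar_replicate_two_succ (n N : ℕ) :
    truncStar (List.replicate (n + 1) 2) 1 (N + 1) =
      truncStar (List.replicate (n + 1) 2) 1 N +
        (((N : ℝ) + 1) ^ 2)⁻¹ * truncStar (List.replicate n 2) 1 (N + 1) := by
  rw [List.replicate_succ']
  simpa using truncStar_append_singleton_succ (List.replicate n 2) 2 (Nat.le_add_left 1 N)

theorem truncStar_replicate_two (n N : ℕ) :
    truncStar (List.replicate n 2) 1 (N + 1) =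
      ∑ k ∈ Finset.range (N + 1), centralRatio (N + 1) (k + 1) *
        ((-1) ^ k * 2 / ((k : ℝ) + 1) ^ (2 * n)) := by
  induction n generalizing N with
  | zero =>
    have h := sum_alternating_centralRatio (Nat.succ_pos N)
    simp only [Nat.succ_eq_add_one] at h
    calc truncStar (List.replicate 0 2) 1 (N + 1) = 2 * (1 / 2) := by simp [truncStar]
      _ = _ := by
        rw [← h, Finset.mul_sum]
        refine Finset.sum_congr rfl fun k _ => ?_
        simp
        ring
  | succ n ih =>
    -- For exponent n + 1 the formula also holds at N = 0, where the induction starts; for n = 0 it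
    -- fails there (1 against an empty sum).
    have key : ∀ N : ℕ, truncStar (List.replicate (n + 1) 2) 1 N =
        ∑ k ∈ Finset.range N, centralRatio N (k + 1) *
          ((-1) ^ k * 2 / ((k : ℝ) + 1) ^ (2 * (n + 1))) := by
      intro N
      induction N with
      | zero => simp [List.replicate_succ, truncStar]
      | succ N ihN =>
        rw [truncStar_replicate_two_succ, ihN, ih, sum_range_centralRatio_mul, Finset.mul_sum,
          ← Finset.sum_add_distrib]
        refine Finset.sum_congr rfl fun k _ => ?_
        have h1 : (N : ℝ) + 1 ≠ 0 := by positivity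
        have h2 : (k : ℝ) + 1 ≠ 0 := by positivity
        rw [centralRatio_succ_left N (k + 1)]
        push_cast
        rw [show 2 * (n + 1) = 2 * n + 2 by ring, pow_add]
        field_simp
        ring
    exact key (N + 1)

/-- The weighted sum over `a + b = n` of the truncations of `ζ⋆({2}^a, 3, {2}^b)`. -/
noncomputable def weightedTruncSum (n N : ℕ) : ℝ :=
  ∑ p ∈ Finset.HasAntidiagonal.antidiagonal n,
    (2 + if p.1 = 0 then 1 else 0) * truncStar (twosThreeTwos p.1 p.2) 1 N

theorem truncStar_twosThreeTwos_zero_succ (a N : ℕ) :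
    truncStar (twosThreeTwos a 0) 1 (N + 1) = truncStar (twosThreeTwos a 0) 1 N +
      (((N : ℝ) + 1) ^ 3)⁻¹ * truncStar (List.replicate a 2) 1 (N + 1) := by
  simpa [twosThreeTwos] using
    truncStar_append_singleton_succ (List.replicate a 2) 3 (Nat.le_add_left 1 N)

theorem truncStar_twosThreeTwos_succ_succ (a b N : ℕ) :
    truncStar (twosThreeTwos a (b + 1)) 1 (N + 1) = truncStar (twosThreeTwos a (b + 1)) 1 N +
      (((N : ℝ) + 1) ^ 2)⁻¹ * truncStar (twosThreeTwos a b) 1 (N + 1) := by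
  have : twosThreeTwos a (b + 1) = twosThreeTwos a b ++ [2] := by
    simp [twosThreeTwos, List.replicate_succ']
  rw [this]
  simpa using truncStar_append_singleton_succ (twosThreeTwos a b) 2 (Nat.le_add_left 1 N)

theorem weightedTruncSum_index_zero (n : ℕ) : weightedTruncSum n 0 = 0 := by
  refine Finset.sum_eq_zero fun p _ => ?_
  have : truncStar (twosThreeTwos p.1 p.2) 1 0 = 0 := by
    cases h : p.1 <;> simp [twosThreeTwos, List.replicate_succ, truncStar]
  rw [this, mul_zero]

theorem weightedTruncSum_zero_succ (N : ℕ) :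
    weightedTruncSum 0 (N + 1) = weightedTruncSum 0 N + 3 / ((N : ℝ) + 1) ^ 3 := by
  simp [weightedTruncSum, truncStar_twosThreeTwos_zero_succ, truncStar]
  ring

/-- Dropping a final 2 keeps a, hence the weight. The only word ending in 3 has a = n + 1 > 0, hence
weight 2. -/
theorem weightedTruncSum_succ_succ (n N : ℕ) :
    weightedTruncSum (n + 1) (N + 1) = weightedTruncSum (n + 1) N +
      weightedTruncSum n (N + 1) / ((N : ℝ) + 1) ^ 2 +
      2 / ((N : ℝ) + 1) ^ 3 * truncStar (List.replicate (n + 1) 2) 1 (N + 1) := by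
  simp only [weightedTruncSum]
  rw [Finset.Nat.sum_antidiagonal_succ', Finset.Nat.sum_antidiagonal_succ']
  simp only [truncStar_twosThreeTwos_zero_succ, truncStar_twosThreeTwos_succ_succ, mul_add,
    Finset.sum_add_distrib, Finset.sum_div]
  simp only [Nat.add_eq_zero_iff, one_ne_zero, and_false, if_false]
  have : ∀ p ∈ Finset.HasAntidiagonal.antidiagonal n, (2 + if p.1 = 0 then (1 : ℝ) else 0) *
      ((((N : ℝ) + 1) ^ 2)⁻¹ * truncStar (twosThreeTwos p.1 p.2) 1 (N + 1)) =
      (2 + if p.1 = 0 then (1 : ℝ) else 0) * truncStar (twosThreeTwos p.1 p.2) 1 (N + 1) /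
        ((N : ℝ) + 1) ^ 2 := fun p _ => by ring
  rw [Finset.sum_congr rfl this]
  ring

/-- With M = N + 1 and x = k + 1, w_N (h_N - h_M) = w_M x(M-x)/M³. Its two parts lower c + 1 to c
and cancel the final M⁻³ term. -/
theorem weighted_recurrence (N k n : ℕ) (c : ℝ) :
    centralRatio (N + 1) (k + 1) * ((c + 1) / ((k : ℝ) + 1) ^ (n + 3) +
        harmonicGap (N + 1) (k + 1) / ((k : ℝ) + 1) ^ (n + 2)) =
      centralRatio N (k + 1) * ((c + 1) / ((k : ℝ) + 1) ^ (n + 3) +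
        harmonicGap N (k + 1) / ((k : ℝ) + 1) ^ (n + 2)) +
      centralRatio (N + 1) (k + 1) * (c / ((k : ℝ) + 1) ^ (n + 1) +
        harmonicGap (N + 1) (k + 1) / ((k : ℝ) + 1) ^ n) / ((N : ℝ) + 1) ^ 2 +
      centralRatio (N + 1) (k + 1) / ((k : ℝ) + 1) ^ n / ((N : ℝ) + 1) ^ 3 := by
  have h1 : (N : ℝ) + 1 ≠ 0 := by positivity
  have h2 : (k : ℝ) + 1 ≠ 0 := by positivity
  have h3 : (N : ℝ) + 1 + (k + 1) ≠ 0 := by positivity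
  rw [centralRatio_succ_left N (k + 1), harmonicGap_succ_left N (k + 1)]
  generalize centralRatio (N + 1) (k + 1) = w
  generalize harmonicGap (N + 1) (k + 1) = h
  push_cast
  generalize (k : ℝ) + 1 = x at *
  generalize (N : ℝ) + 1 = M at *
  simp only [pow_add]
  field_simp
  ring

theorem weightedTruncSum_eq (n N : ℕ) :
    weightedTruncSum n N = ∑ k ∈ Finset.range N, centralRatio N (k + 1) *
      ((-1) ^ k * 4 * ((n + 1) / ((k : ℝ) + 1) ^ (2 * n + 3) +
        harmonicGap N (k + 1) / ((k : ℝ) + 1) ^ (2 * n + 2))) := by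
  induction n generalizing N with
  | zero =>
    induction N with
    | zero => simp [weightedTruncSum_index_zero]
    | succ N ihN =>
      have h1 : ((N + 1 : ℕ) : ℝ) ≠ 0 := by positivity
      -- The split 3 = 1 + 2 matches the values 1/(4M) and 1/2 of the two alternating sums at M = N
      -- + 1.
      have e : 3 / ((N : ℝ) + 1) ^ 3 =
          (4 / ((N + 1 : ℕ) : ℝ) ^ 2) * (1 / (4 * (N + 1 : ℕ))) +
            (4 / ((N + 1 : ℕ) : ℝ) ^ 3) * (1 / 2) := by
        push_cast at h1 ⊢
        field_simp
        norm_num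
      rw [weightedTruncSum_zero_succ, ihN, sum_range_centralRatio_mul, e,
        ← sum_alternating_centralRatio_mul_harmonicGap (Nat.succ_pos N),
        ← sum_alternating_centralRatio (Nat.succ_pos N), Finset.mul_sum, Finset.mul_sum,
        ← Finset.sum_add_distrib, ← Finset.sum_add_distrib]
      refine Finset.sum_congr rfl fun k _ => ?_
      have h := weighted_recurrence N k 0 0
      simp only [Nat.succ_eq_add_one]
      push_cast at h ⊢
      simp only [pow_zero, zero_div, zero_add, div_one] at h ⊢
      linear_combination (-(-1) ^ k * 4) * h
  | succ n ih =>
    induction N with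
    | zero => simp [weightedTruncSum_index_zero]
    | succ N ihN =>
      rw [weightedTruncSum_succ_succ, ihN, ih, truncStar_replicate_two,
        sum_range_centralRatio_mul, Finset.mul_sum, Finset.sum_div,
        ← Finset.sum_add_distrib, ← Finset.sum_add_distrib]
      refine Finset.sum_congr rfl fun k _ => ?_
      have h := weighted_recurrence N k (2 * n + 2) (n + 1)
      push_cast
      rw [show 2 * (n + 1) + 3 = 2 * n + 2 + 3 by ring, show 2 * (n + 1) + 2 = 2 * n + 2 + 2 by ring,
        show 2 * (n + 1) = 2 * n + 2 by ring]
      linear_combination (-(-1) ^ k * 4) * h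

/-! ### Passage to the limit and zeta values -/

theorem tendsto_weightedTruncSum (n : ℕ) :
    Tendsto (weightedTruncSum n) atTop
      (𝓝 (∑' k : ℕ, (-1) ^ k * 4 * ((n + 1) / ((k : ℝ) + 1) ^ (2 * n + 3)))) := by
  have e : ∀ N, weightedTruncSum n N = ∑' k : ℕ, centralRatio N (k + 1) *
      ((-1) ^ k * 4 * ((n + 1) / ((k : ℝ) + 1) ^ (2 * n + 3) +
        harmonicGap N (k + 1) / ((k : ℝ) + 1) ^ (2 * n + 2))) := fun N => by
    rw [weightedTruncSum_eq, tsum_eq_sum]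
    intro k hk
    rw [centralRatio_eq_zero (by simpa [Nat.lt_succ_iff] using hk), zero_mul]
  rw [show weightedTruncSum n = _ from funext e]
  have hs : Summable fun k : ℕ => 1 / ((k : ℝ) + 1) ^ 2 := by
    have := (summable_nat_add_iff 1).2 (Real.summable_one_div_nat_pow.2 one_lt_two)
    exact_mod_cast this
  -- In the bound, n + 1 comes from w ≤ 1 and the further 1 from w h ≤ 1.
  refine tendsto_tsum_of_dominated_convergence (hs.mul_left (4 * ((n : ℝ) + 1 + 1))) ?_ ?_
  · intro k
    have h1 := tendsto_centralRatio (k + 1)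
    have h2 := tendsto_harmonicGap (k + 1)
    have := h1.mul (((h2.div_const (((k : ℝ) + 1) ^ (2 * n + 2))).const_add
      ((n + 1) / ((k : ℝ) + 1) ^ (2 * n + 3))).const_mul ((-1) ^ k * 4))
    simpa using this
  · refine Eventually.of_forall fun N k => ?_
    have hx : (1 : ℝ) ≤ (k : ℝ) + 1 := by linarith [Nat.cast_nonneg (α := ℝ) k]
    have hw := centralRatio_nonneg N (k + 1)
    have hh := harmonicGap_nonneg N (k + 1)
    have hp : ∀ m, 1 / ((k : ℝ) + 1) ^ (m + 2) ≤ 1 / ((k : ℝ) + 1) ^ 2 := fun m =>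
      one_div_le_one_div_of_le (by positivity) (pow_le_pow_right₀ hx (Nat.le_add_left 2 m))
    rw [norm_mul, norm_mul, norm_mul, norm_pow, norm_neg, norm_one, one_pow, one_mul,
      Real.norm_of_nonneg hw, Real.norm_of_nonneg (by norm_num : (0 : ℝ) ≤ 4),
      Real.norm_of_nonneg (by positivity)]
    have a1 : centralRatio N (k + 1) * (((n : ℝ) + 1) / ((k : ℝ) + 1) ^ (2 * n + 3)) ≤
        (n + 1) * (1 / ((k : ℝ) + 1) ^ 2) := by
      rw [div_eq_mul_one_div]
      calc _ ≤ 1 * (((n : ℝ) + 1) * (1 / ((k : ℝ) + 1) ^ (2 * n + 3))) :=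
            mul_le_mul_of_nonneg_right (centralRatio_le_one _ _) (by positivity)
        _ ≤ _ := by
            rw [one_mul]
            exact mul_le_mul_of_nonneg_left (hp (2 * n + 1)) (by positivity)
    have a2 : centralRatio N (k + 1) * (harmonicGap N (k + 1) / ((k : ℝ) + 1) ^ (2 * n + 2)) ≤
        1 / ((k : ℝ) + 1) ^ 2 := by
      rw [div_eq_mul_one_div, ← mul_assoc]
      calc _ ≤ 1 * (1 / ((k : ℝ) + 1) ^ (2 * n + 2)) :=
            mul_le_mul_of_nonneg_right (centralRatio_mul_harmonicGap_le_one _ _) (by positivity)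
        _ ≤ _ := by
            rw [one_mul]
            exact hp (2 * n)
    linarith

theorem tsum_alternating_eq {s : ℕ} (hs : 1 < s) :
    ∑' k : ℕ, (-1 : ℝ) ^ k / ((k : ℝ) + 1) ^ s =
      (1 - 2 / 2 ^ s) * ∑' k : ℕ, 1 / (k : ℝ) ^ s := by
  set f : ℕ → ℝ := fun k => 1 / (k : ℝ) ^ s
  have hf : Summable f := Real.summable_one_div_nat_pow.2 hs
  have heven : Summable fun k : ℕ => f (2 * k) :=
    hf.comp_injective (mul_right_injective₀ two_ne_zero)
  have hodd : Summable fun k : ℕ => f (2 * k + 1) :=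
    hf.comp_injective ((add_left_injective 1).comp (mul_right_injective₀ two_ne_zero))
  have hf0 : f 0 = 0 := by simp [f, (zero_lt_one.trans hs).ne']
  have hscale : ∑' k : ℕ, f (2 * k) = 1 / 2 ^ s * ∑' k : ℕ, f k := by
    rw [← tsum_mul_left]
    refine tsum_congr fun k => ?_
    simp only [f, Nat.cast_mul, Nat.cast_ofNat, mul_pow]
    rw [one_div_mul_one_div]
  have hg : Summable fun k : ℕ => (-1 : ℝ) ^ k * f k :=
    Summable.of_norm (hf.norm.congr fun k => by simp)
  have hsign : ∀ k : ℕ, (-1 : ℝ) ^ (2 * k) = 1 := fun k => by rw [pow_mul]; simp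
  have e1 := tsum_even_add_odd heven hodd
  have e2 := tsum_even_add_odd (f := fun k : ℕ => (-1 : ℝ) ^ k * f k)
    (by simpa only [hsign, one_mul] using heven)
    (by simpa only [pow_succ, hsign, one_mul, neg_mul] using hodd.neg)
  have e3 := hg.tsum_eq_zero_add
  have e4 : ∑' k : ℕ, (-1 : ℝ) ^ (k + 1) * f (k + 1) =
      -∑' k : ℕ, (-1 : ℝ) ^ k / ((k : ℝ) + 1) ^ s := by
    rw [← tsum_neg]
    refine tsum_congr fun k => ?_
    simp only [f, pow_succ, Nat.cast_succ]
    ring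
  simp only [pow_succ, hsign, one_mul, neg_mul, tsum_neg] at e2
  rw [e4, hf0, mul_zero, zero_add] at e3
  linear_combination e1 + e2 + e3 - 2 * hscale

theorem tsum_weighted_eq_zeta (n : ℕ) :
    ((∑' k : ℕ, (-1) ^ k * 4 * ((n + 1) / ((k : ℝ) + 1) ^ (2 * n + 3)) : ℝ) : ℂ) =
      2 * (2 * (n : ℂ) + 2) * (1 - 1 / 2 ^ (2 * n + 2)) * riemannZeta (2 * (n : ℂ) + 3) := by
  have h1 : ∑' k : ℕ, (-1) ^ k * 4 * (((n : ℝ) + 1) / ((k : ℝ) + 1) ^ (2 * n + 3)) =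
      4 * (n + 1) * ∑' k : ℕ, (-1 : ℝ) ^ k / ((k : ℝ) + 1) ^ (2 * n + 3) := by
    rw [← tsum_mul_left]
    exact tsum_congr fun k => by ring
  have h2 := zeta_nat_eq_tsum_of_gt_one (k := 2 * n + 3) (by omega)
  push_cast at h2
  rw [h1, tsum_alternating_eq (by omega), h2]
  push_cast
  rw [show 2 * n + 3 = 2 * n + 2 + 1 by ring, pow_succ (2 : ℂ)]
  field_simp
  ring

/-- All truncations are nonnegative with weights at least 1, so each is bounded by the weighted sum,
which converges by its closed form. -/
theorem summable_twosThreeTwos (n : ℕ) :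
    ∀ p ∈ Finset.HasAntidiagonal.antidiagonal n, Summable (mzsvTerm (twosThreeTwos p.1 p.2)) := by
  intro p hp
  obtain ⟨C, hC⟩ := (tendsto_weightedTruncSum n).bddAbove_range
  refine summable_mzsvTerm_of_truncStar_le (C := C) fun N => ?_
  refine le_trans ?_ (hC ⟨N, rfl⟩)
  have hnn : ∀ q : ℕ × ℕ, (1 : ℝ) ≤ 2 + if q.1 = 0 then 1 else 0 := fun q => by
    split_ifs <;> norm_num
  refine le_trans ?_ (Finset.single_le_sum (f := fun q : ℕ × ℕ =>
    (2 + if q.1 = 0 then 1 else 0) * truncStar (twosThreeTwos q.1 q.2) 1 N)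
    (fun q _ => mul_nonneg (zero_le_one.trans (hnn q)) (truncStar_nonneg _ _ _)) hp)
  exact le_mul_of_one_le_left (truncStar_nonneg _ _ _) (hnn p)

theorem weighted_sum_zetaStar_eq (n : ℕ) :
    ∑ p ∈ Finset.HasAntidiagonal.antidiagonal n,
        (2 + if p.1 = 0 then 1 else 0) * zetaStar (twosThreeTwos p.1 p.2) =
      ∑' k : ℕ, (-1) ^ k * 4 * (((n : ℝ) + 1) / ((k : ℝ) + 1) ^ (2 * n + 3)) := by
  refine tendsto_nhds_unique ?_ (tendsto_weightedTruncSum n)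
  exact tendsto_finsetSum _ fun p hp =>
    (tendsto_truncStar (summable_twosThreeTwos n p hp)).const_mul _

theorem mainTheorem6 (n : ℕ) :
    (∀ p ∈ Finset.HasAntidiagonal.antidiagonal n, Summable (mzsvTerm (twosThreeTwos p.1 p.2))) ∧
    ((∑ p ∈ Finset.HasAntidiagonal.antidiagonal n,
        (2 + if p.1 = 0 then 1 else 0) * zetaStar (twosThreeTwos p.1 p.2) : ℝ) : ℂ) =
      2 * (2 * (n : ℂ) + 2) * (1 - 1 / 2 ^ (2 * n + 2)) * riemannZeta (2 * (n : ℂ) + 3) ∧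
    (zetaStar (3 :: List.replicate n 2) : ℂ) =
      2 * (2 * (n : ℂ) + 2) * (1 - 1 / 2 ^ (2 * n + 2)) * riemannZeta (2 * (n : ℂ) + 3) -
        2 * ((∑ p ∈ Finset.HasAntidiagonal.antidiagonal n, zetaStar (twosThreeTwos p.1 p.2) : ℝ) : ℂ) := by
  have h := weighted_sum_zetaStar_eq n
  refine ⟨summable_twosThreeTwos n, by rw [h, tsum_weighted_eq_zeta], ?_⟩
  rw [← tsum_weighted_eq_zeta, ← h, ← Complex.ofReal_ofNat, ← Complex.ofReal_mul,
    ← Complex.ofReal_sub]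
  congr 1
  simp only [add_mul, Finset.sum_add_distrib, ite_mul, one_mul, zero_mul, ← Finset.mul_sum]
  have : ∑ p ∈ Finset.HasAntidiagonal.antidiagonal n,
      (if p.1 = 0 then zetaStar (twosThreeTwos p.1 p.2) else 0) =
        zetaStar (3 :: List.replicate n 2) := by
    rw [Finset.sum_eq_single (0, n)]
    · simp [twosThreeTwos]
    · rintro ⟨a, b⟩ hab hne
      rw [if_neg]
      rintro (rfl : a = 0)
      exact hne (by simpa using hab)
    · simp
  rw [this]
  ring
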